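/- Let $d\in\mathbb N$, let $\mathscr D=C_c^\infty(\mathbb R^d;\mathbb C)$ with its dual $\mathscr D'$ (continuous $\mathbb C$-linear functionals), and write $\langle f,g\rangle=\int\bar f g$ for $f,g\in\mathscr D$ and $\langle f,T\rangle=T(\bar f)$ for $f\in\mathscr D$, $T\in\mathscr D'$. Let $\varpi:\mathbb R^d\to\mathbb R$ be smooth with $\varpi\ge\mu$ for some constant $\mu>0$; multiplication by smooth functions of $\varpi$ (such as $e^{it\varpi}$ and $1/\varpi$) acts on $\mathscr D$, and on $\mathscr D'$ by transposition. Let $\mathbb W$ be the C*-algebra of canonical commutation relations over $(\mathscr D,\operatorname{Im}\langle\cdot,\cdot\rangle)$, generated by nonzero elements $W(f)$, $f\in\mathscr D$, with $W(f)^*=W(-f)$ and $W(f)W(g)=e^{-i\pi^2\operatorname{Im}\langle f,g\rangle}W(f+g)$. Let $v\in\mathscr D'$ be any source. Then the following hold. 1. There is a unique one-parameter group $(\tau(t))_{t\in\mathbb R}$ of isometric $*$-automorphisms of $\mathbb W$ (the van Hove–Miyatake dynamical map with source $v$) such that, for all $t\in\mathbb R$ and $f\in\mathscr D$, $$\tau(t)[W(f)]=e^{2\pi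 i\operatorname{Re}\langle f,(e^{-it\varpi}-1)v/\varpi\rangle}\,W(e^{it\varpi}f).$$ 2. There is a unique state $\omega_\infty$ on $\mathbb W$ that is regular (i.e. $\lambda\mapsto\omega_\infty(W(\lambda f))$ is continuous on $\mathbb R$ for every $f\in\mathscr D$) and satisfies, for all $f\in\mathscr D$, $$\omega_\infty(W(f))=e^{-\frac{\pi^2}{2}\langle f,f\rangle}\,e^{2\pi i\operatorname{Re}\langle f,-v/\varpi\rangle}$$ (the algebraic coherent state centred at $-v/\varpi$). 3. $\omega_\infty$ is a ground state for $\tau$: for all $a,b\in\mathbb W$ and every $F:\mathbb R\to\mathbb C$ of the form $F(t)=\int_{\mathbb R}\varphi(p)e^{-2\pi ipt}\,dp$ with $\varphi\in C_c^\infty((-\infty,0);\mathbb C)$ (equivalently, $\hat F(p)=\int F(t)e^{2\pi ipt}\,dt$ is smooth with compact support in $(-\infty,0)$), the function $t\mapsto F(t)\,\omega_\infty(a\,\tau(t)[b])$ is integrable and $$\int_{\mathbb R}F(t)\,\omega_\infty\bigl(a\,\tau(t)[b]\bigr)\,dt=0.$$ -/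

import Mathlib

noncomputable section

namespace VanHove

open MeasureTheory TopologicalSpace
open scoped Distributions ComplexConjugate

/-! ### Test functions and distributions on momentum space -/

/-- Momentum space `ℝ^d` with its Euclidean norm. -/
abbrev Mom (d : ℕ) : Type := EuclideanSpace ℝ (Fin d)

/-- `𝒟(ℝ^d)`: complex-valued smooth compactly supported functions, with the LF topology. -/
abbrev Test (d : ℕ) : Type := 𝓓((⊤ : Opens (Mom d)), ℂ)

/-- `𝒟'(ℝ^d)`: continuous `ℂ`-linear functionals on `𝒟(ℝ^d)`. -/
abbrev Distr (d : ℕ) : Type := Test d →L[ℂ] ℂ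

variable {d : ℕ}

section Multiplication

open scoped ContDiff

/-- Multiplication `f ↦ m f` by a smooth function `m`, as a continuous operator on `𝒟`. -/
def mulTest (m : Mom d → ℂ) (hm : ContDiff ℝ ∞ m) : Test d →L[ℂ] Test d :=
  TestFunction.limitCLM ℂ
    (fun f => ⟨fun k => m k * f k, hm.mul f.contDiff, f.hasCompactSupport.mul_left, by simp⟩)
    (fun _ hK => TestFunction.ofSupportedInCLM ℂ hK ∘L
      ContDiffMapSupportedIn.bilinLeftCLM (ContinuousLinearMap.mul ℂ ℂ) hm)
    (fun _ _ f => by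
      ext k
      simp [mul_comm])

/-- Helper fact: the values of the multiplication operator. -/
theorem mulTest_apply (m : Mom d → ℂ) (hm : ContDiff ℝ ∞ m) (f : Test d) (k : Mom d) :
    mulTest m hm f k = m k * f k := rfl

/-- Multiplication of a distribution by a smooth function, by transposition. -/
def mulDistr (m : Mom d → ℂ) (hm : ContDiff ℝ ∞ m) (T : Distr d) : Distr d :=
  T ∘L mulTest m hm

/-- Complex conjugation `f ↦ f̄` on `𝒟`. -/
def conjTest : Test d →L[ℝ] Test d :=
  TestFunction.postcompCLM (Complex.conjCLE : ℂ →L[ℝ] ℂ)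

/-- Helper fact: the values of the conjugated test function. -/
theorem conjTest_apply (f : Test d) (k : Mom d) : conjTest f k = conj (f k) := rfl

/-- The sesquilinear bracket `⟨f, T⟩ = T(f̄)` between `𝒟` and `𝒟'`. -/
def bracket (f : Test d) (T : Distr d) : ℂ := T (conjTest f)

/-- The `L²` inner product `⟨f, g⟩ = ∫ f̄ g` on `𝒟`, antilinear in the first variable. -/
def ip (f g : Test d) : ℂ := ∫ k, conj (f k) * g k

/-! ### The dispersion relation -/

/-- A boson dispersion relation: a multiplication operator that maps `𝒟(ℝ^d)` to itself (that is,
multiplication by a smooth function) and is bounded below by a positive mass. -/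
structure Dispersion (d : ℕ) where
  /-- the function `k ↦ ϖ(k)` -/
  toFun : Mom d → ℝ
  smooth : ContDiff ℝ ∞ toFun
  /-- the mass -/
  mass : ℝ
  mass_pos : 0 < mass
  mass_le : ∀ k, mass ≤ toFun k

namespace Dispersion

variable (ϖ : Dispersion d)

/-- Helper fact: `ϖ` is smooth as a complex-valued function. -/
theorem contDiff_ofReal : ContDiff ℝ ∞ (fun k => (ϖ.toFun k : ℂ)) :=
  Complex.ofRealCLM.contDiff.comp ϖ.smooth

/-- Helper fact: `k ↦ e^{itϖ(k)}` is smooth. -/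
theorem contDiff_exp (t : ℝ) :
    ContDiff ℝ ∞ (fun k => Complex.exp (Complex.I * t * ϖ.toFun k)) :=
  (contDiff_const.mul ϖ.contDiff_ofReal).cexp

/-- Helper fact: `k ↦ 1/ϖ(k)` is smooth. -/
theorem contDiff_inv : ContDiff ℝ ∞ (fun k => ((ϖ.toFun k : ℂ))⁻¹) :=
  ϖ.contDiff_ofReal.inv fun k =>
    Complex.ofReal_ne_zero.mpr (ϖ.mass_pos.trans_le (ϖ.mass_le k)).ne'

/-- The operator `e^{itϖ}` on `𝒟`. -/
def evol (t : ℝ) : Test d →L[ℂ] Test d := mulTest _ (ϖ.contDiff_exp t)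

/-- The operator `e^{itϖ}` on `𝒟'`. -/
def evolDistr (t : ℝ) (T : Distr d) : Distr d := mulDistr _ (ϖ.contDiff_exp t) T

/-- The distribution `v/ϖ`. -/
def divDistr (v : Distr d) : Distr d := mulDistr _ ϖ.contDiff_inv v

end Dispersion

end Multiplication

/-! ### The C*-algebra of canonical commutation relations

For the non-degenerate symplectic space `(𝒟, Im⟨·,·⟩)` the C*-algebra generated by Weyl operators is
unique up to isomorphism; it is realised on `ℓ²(𝒟)`, where `𝒟` is taken as a discrete set, by
`W(f) δ_h = e^{-iπ² Im⟨f,h⟩} δ_{f+h}`. -/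

/-- The Hilbert space `ℓ²(𝒟)`. -/
abbrev Ell2 (d : ℕ) : Type := lp (fun _ : Test d => ℂ) 2

/-- The Weyl phase `e^{-iπ² Im⟨f,g⟩}`. -/
def weylPhase (f g : Test d) : ℂ :=
  Complex.exp (-(Complex.I * (Real.pi ^ 2 * (ip f g).im : ℝ)))

theorem norm_weylPhase (f g : Test d) : ‖weylPhase f g‖ = 1 := by
  have : -(Complex.I * (Real.pi ^ 2 * (ip f g).im : ℝ)) =
      ((-(Real.pi ^ 2 * (ip f g).im) : ℝ) : ℂ) * Complex.I := by
    push_cast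
    ring
  rw [weylPhase, this, Complex.norm_exp_ofReal_mul_I]

theorem weyl_memℓp (f : Test d) (ψ : Ell2 d) :
    Memℓp (fun h : Test d => weylPhase f h * ψ (h - f)) 2 := by
  have h2 : (0 : ℝ) < (2 : ENNReal).toReal := by norm_num
  have h := (memℓp_gen_iff h2).1 (lp.memℓp ψ)
  refine (memℓp_gen_iff h2).2 ?_
  simp only [norm_mul, norm_weylPhase, one_mul]
  exact (Equiv.subRight f).summable_iff.mpr h

/-- The operator `(W(f)ψ)(h) = e^{-iπ² Im⟨f,h⟩} ψ(h - f)` on `ℓ²(𝒟)`. -/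
def weylOp (f : Test d) : Ell2 d →L[ℂ] Ell2 d :=
  LinearMap.mkContinuous
    { toFun := fun ψ => ⟨fun h => weylPhase f h * ψ (h - f), weyl_memℓp f ψ⟩
      map_add' := fun ψ χ => by
        ext h
        exact mul_add _ _ _
      map_smul' := fun c ψ => by
        ext h
        simp [mul_left_comm] }
    1 (fun ψ => by
      have h2 : (0 : ℝ) < (2 : ENNReal).toReal := by norm_num
      rw [one_mul, lp.norm_eq_tsum_rpow h2, lp.norm_eq_tsum_rpow h2]
      apply le_of_eq
      congr 1
      simp only [LinearMap.coe_mk, AddHom.coe_mk, norm_mul, norm_weylPhase, one_mul]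
      exact (Equiv.subRight f).tsum_eq (fun h => ‖ψ h‖ ^ (2 : ENNReal).toReal))

/-- Helper fact: the values of the Weyl operators. -/
theorem weylOp_apply (f : Test d) (ψ : Ell2 d) (h : Test d) :
    weylOp f ψ h = weylPhase f h * ψ (h - f) := rfl

/-- The C*-algebra of canonical commutation relations over `(𝒟, Im⟨·,·⟩)`: the norm closure of the
*-algebra generated by the Weyl operators. -/
def ccrAlgebra (d : ℕ) : StarSubalgebra ℂ (Ell2 d →L[ℂ] Ell2 d) :=
  (StarAlgebra.adjoin ℂ (Set.range (weylOp (d := d)))).topologicalClosure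

/-- The C*-algebra of canonical commutation relations, as a type. -/
abbrev CCR (d : ℕ) : Type := ccrAlgebra d

/-- The Weyl operator `W(f)` as an element of the C*-algebra. -/
def W (f : Test d) : CCR d :=
  ⟨weylOp f, StarSubalgebra.le_topologicalClosure _
    (StarAlgebra.subset_adjoin ℂ _ (Set.mem_range_self f))⟩

/-! The Weyl relations, proved as a check of the realisation. -/

theorem integrable_conj_mul (f g : Test d) : Integrable fun k => conj (f k) * g k := by
  refine Continuous.integrable_of_hasCompactSupport ?_ g.hasCompactSupport.mul_left
  exact (Complex.continuous_conj.comp f.continuous).mul g.continuous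

theorem ip_add_left (f g h : Test d) : ip (f + g) h = ip f h + ip g h := by
  simp only [ip]
  rw [← integral_add (integrable_conj_mul f h) (integrable_conj_mul g h)]
  simp [add_mul]

theorem ip_add_right (f g h : Test d) : ip f (g + h) = ip f g + ip f h := by
  simp only [ip]
  rw [← integral_add (integrable_conj_mul f g) (integrable_conj_mul f h)]
  simp [mul_add]

theorem conj_ip (f g : Test d) : conj (ip f g) = ip g f := by
  simp only [ip]
  rw [← integral_conj]
  simp [mul_comm]

theorem ip_neg_left (f g : Test d) : ip (-f) g = -ip f g := by
  simp [ip, integral_neg]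

theorem ip_im_comm (f g : Test d) : (ip f g).im = -(ip g f).im := by
  rw [← conj_ip g f]
  simp

theorem ip_self_im (f : Test d) : (ip f f).im = 0 := by
  have := ip_im_comm f f
  linarith

/-- `W(f) W(g) = e^{-iπ² Im⟨f,g⟩} W(f + g)`. -/
theorem W_mul_W (f g : Test d) : W f * W g = weylPhase f g • W (f + g) := by
  apply Subtype.ext
  ext ψ h
  change weylPhase f h * (weylPhase g (h - f) * ψ (h - f - g)) =
    weylPhase f g * (weylPhase (f + g) h * ψ (h - (f + g)))
  rw [sub_sub, ← mul_assoc, ← mul_assoc]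
  congr 1
  simp only [weylPhase, ← Complex.exp_add]
  congr 1
  have h1 : (ip g (h - f)).im = (ip g h).im + (ip f g).im := by
    have := congrArg Complex.im (ip_add_right g (h - f) f)
    rw [sub_add_cancel, Complex.add_im, ip_im_comm g f] at this
    linarith
  rw [h1, ip_add_left, Complex.add_im]
  push_cast
  ring

theorem W_zero : W (0 : Test d) = 1 := by
  apply Subtype.ext
  ext ψ h
  change weylPhase 0 h * ψ (h - 0) = ψ h
  simp [weylPhase, ip]

/-- `W(f)* = W(-f)`. -/
theorem star_W (f : Test d) : star (W f) = W (-f) := by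
  apply Subtype.ext
  change ContinuousLinearMap.adjoint (weylOp f) = weylOp (-f)
  symm
  rw [ContinuousLinearMap.eq_adjoint_iff]
  intro ψ χ
  rw [lp.inner_eq_tsum, lp.inner_eq_tsum,
    ← (Equiv.addRight f).tsum_eq (fun h => inner ℂ (ψ h) (weylOp f χ h))]
  refine tsum_congr fun h => ?_
  simp only [Equiv.coe_addRight, weylOp_apply, RCLike.inner_apply, map_mul]
  have h1 : (ip f (h + f)).im = (ip f h).im := by
    rw [ip_add_right, Complex.add_im, ip_self_im, add_zero]
  have h2 : weylPhase f (h + f) = conj (weylPhase (-f) h) := by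
    simp only [weylPhase, h1, ← Complex.exp_conj, ip_neg_left]
    simp
  rw [h2, add_sub_cancel_right, sub_neg_eq_add]
  ring

/-- `W(f) ≠ 0`. -/
theorem W_ne_zero (f : Test d) : W f ≠ 0 := by
  classical
  intro h0
  have h1 : (W f * W (-f) : CCR d) = weylPhase f (-f) • (1 : CCR d) := by
    rw [W_mul_W, add_neg_cancel, W_zero]
  rw [h0, zero_mul] at h1
  have h2 := congrArg (fun a : CCR d => (a : Ell2 d →L[ℂ] Ell2 d) (lp.single 2 0 1) 0) h1
  have h3 : (0 : ℂ) = weylPhase f (-f) * (lp.single (E := fun _ : Test d => ℂ) 2 0 1 : Ell2 d) 0 :=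
    h2
  rw [lp.single_apply_self, mul_one] at h3
  have h4 := norm_weylPhase f (-f)
  rw [← h3, norm_zero] at h4
  exact zero_ne_one h4

/-! ### The van Hove-Miyatake dynamical map -/

/-- `τ` is the quantum van Hove-Miyatake dynamical map with source `v`: a one-parameter group of
*-automorphisms of the CCR algebra such that
`τ(t)[W(f)] = e^{2πi Re⟨f, (e^{-itϖ} - 1)v/ϖ⟩} W(e^{itϖ}f)`. -/
structure IsDynamicalMap (ϖ : Dispersion d) (v : Distr d) (τ : ℝ → (CCR d ≃⋆ₐ[ℂ] CCR d)) :
    Prop where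
  map_zero : ∀ a, τ 0 a = a
  map_add : ∀ s t a, τ (s + t) a = τ s (τ t a)
  isometry : ∀ t, Isometry (τ t)
  map_W : ∀ t f, τ t (W f) =
    Complex.exp (2 * Real.pi * Complex.I *
      (bracket f (ϖ.evolDistr (-t) (ϖ.divDistr v) - ϖ.divDistr v)).re) • W (ϖ.evol t f)

/-! ### States -/

/-- A state: a normalised positive (continuous) linear functional. -/
structure IsState (ω : CCR d →L[ℂ] ℂ) : Prop where
  map_one : ω 1 = 1
  nonneg : ∀ a, 0 ≤ (ω (star a * a)).re ∧ (ω (star a * a)).im = 0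

/-- `ω` is the algebraic coherent state centred at the distribution `T`: the regular normalised
state with `ω(W(f)) = e^{-(π²/2)⟨f,f⟩} e^{2πi Re⟨f,T⟩}`. -/
structure IsCoherentState (T : Distr d) (ω : CCR d →L[ℂ] ℂ) : Prop where
  isState : IsState ω
  regular : ∀ f : Test d, Continuous fun s : ℝ => ω (W (s • f))
  apply_W : ∀ f, ω (W f) = Complex.exp (-(Real.pi ^ 2 / 2) * ip f f) *
    Complex.exp (2 * Real.pi * Complex.I * (bracket f T).re)

/-- The inverse Fourier transform `F(t) = ∫ φ(p) e^{-2πipt} dp`, so that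
`φ(p) = F̂(p) = ∫ F(t) e^{2πipt} dt`. -/
def invFourier (φ : ℝ → ℂ) (t : ℝ) : ℂ :=
  ∫ p : ℝ, φ p * Complex.exp (-(2 * Real.pi * Complex.I * p * t))

/-- `ω` is a ground state for `τ`: a state such that `∫ F(t) ω(a τ(t)[b]) dt = 0` for all `a`, `b` in
the algebra and all `F` whose Fourier transform `F̂(p) = ∫ F(t) e^{2πipt} dt` is smooth with compact
support in `(-∞, 0)`. The integrand is required to be integrable. -/
structure IsGroundState (τ : ℝ → (CCR d ≃⋆ₐ[ℂ] CCR d)) (ω : CCR d →L[ℂ] ℂ) : Prop where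
  isState : IsState ω
  integrable : ∀ (φ : 𝓓((⟨Set.Iio 0, isOpen_Iio⟩ : Opens ℝ), ℂ)) (a b : CCR d),
    Integrable fun t : ℝ => invFourier φ t * ω (a * τ t b)
  integral_eq_zero : ∀ (φ : 𝓓((⟨Set.Iio 0, isOpen_Iio⟩ : Opens ℝ), ℂ)) (a b : CCR d),
    ∫ t : ℝ, invFourier φ t * ω (a * τ t b) = 0

end VanHove

end

/-!
The Weyl operators span a dense subspace of the CCR algebra (`dense_span_W`), because products and
adjoints of Weyl operators are multiples of Weyl operators. This gives uniqueness of the dynamics and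
of the coherent state, and it reduces the ground state condition to Weyl operators.

*Dynamics.* On `ℓ²(𝒟)` the unitary `(Uψ)(h) = χ(h) ψ(T⁻¹h)`, for a symplectic group automorphism `T`
of `𝒟` and a character `χ`, conjugates `W(f)` into `χ(Tf) W(Tf)`; hence it normalises the CCR algebra
(`exists_weylAut`). With `T = e^{itϖ}` and the van Hove phase this is `τ(t)`, and the group law is a
cocycle identity for the phases.

*Coherent state.* The prescribed values `Φ(f)` have a positive semidefinite twisted kernel, since this
kernel is `conj Φ(f) · e^{π²⟨f,g⟩} · Φ(g)` and entrywise exponentials of Gram matrices are positive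
semidefinite (`posSemidef_coherentValue`). What needs an argument is that the functional is bounded in
the norm of the concrete representation on `ℓ²(𝒟)`. This is where amenability of the abelian group
`𝒟` enters: compressing the kernel to an almost invariant finite set gives density matrices on
`ℓ²(𝒟)` whose expectations converge to the functional (`exists_foelner`,
`norm_linearCombination_le`).

*Ground state.* In the coherent state centred at `-v/ϖ` the phases of the dynamics cancel, and
`ω(W(f) τ(t)[W(g)]) = ω(W(f)) ω(W(g)) e^{-π²⟨f, e^{itϖ}g⟩}`. As `⟨f, e^{itϖ}g⟩ = ∫ f̄ g e^{itϖ}` with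
`ϖ > 0`, every term of the exponential series is a superposition of frequencies `≥ 0`, so its integral
against a function `F` with negative frequencies is zero (`IsNegFreq.integral_mul_exp_ip`).
-/

noncomputable section

namespace VanHove

open MeasureTheory TopologicalSpace Filter
open scoped Distributions ComplexConjugate ComplexOrder Topology Matrix

/-! ### Amenability of abelian groups -/

/-- Abelian groups are amenable: every finite set `S` has an `ε`-invariant nonempty finite set `F`.
The boxes `{∑ n_g g : 0 ≤ n_g ≤ N}` over `g ∈ S` have polynomial growth in `N`, so that some box is
almost as large as the next one, which contains all its translates by `S`. -/
theorem exists_foelner {G : Type*} [AddCommGroup G] [DecidableEq G] (S : Finset G) {ε : ℝ}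
    (hε : 0 < ε) : ∃ F : Finset G, F.Nonempty ∧
      ∀ g ∈ S, ((F.filter fun h => h - g ∉ F).card : ℝ) ≤ ε * F.card := by
  let B : ℕ → Finset G := fun N =>
    (Fintype.piFinset fun _ : S => Finset.range (N + 1)).image fun n => ∑ g : S, n g • (g : G)
  have memB : ∀ N x, x ∈ B N ↔ ∃ n : S → ℕ, (∀ g, n g ≤ N) ∧ ∑ g : S, n g • (g : G) = x := by
    intro N x
    simp [B]
  have cardB : ∀ N, (B N).card ≤ (N + 1) ^ S.card := fun N => by
    refine Finset.card_image_le.trans ?_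
    simp
  have subB : ∀ N, B N ⊆ B (N + 1) := fun N x hx => by
    obtain ⟨n, hn, rfl⟩ := (memB N x).1 hx
    exact (memB _ _).2 ⟨n, fun g => (hn g).trans N.le_succ, rfl⟩
  have addB : ∀ N, ∀ g ∈ S, ∀ x ∈ B N, x + g ∈ B (N + 1) := by
    intro N g hg x hx
    obtain ⟨n, hn, rfl⟩ := (memB N x).1 hx
    refine (memB _ _).2 ⟨n + Pi.single ⟨g, hg⟩ 1, fun a => ?_, ?_⟩
    · have : (Pi.single (⟨g, hg⟩ : S) 1 : S → ℕ) a ≤ 1 := by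
        rw [Pi.single_apply]; split_ifs <;> simp
      exact add_le_add (hn a) this
    · simp [add_smul, Finset.sum_add_distrib, Pi.single_apply, ite_smul]
  have neB : ∀ N, (B N).Nonempty := fun N => ⟨0, (memB _ _).2 ⟨0, by simp, by simp⟩⟩
  -- polynomial growth forbids `#B (N + 1) > (1 + ε) #B N` for all `N`
  obtain ⟨N, hN⟩ : ∃ N, ((B (N + 1)).card : ℝ) ≤ (1 + ε) * (B N).card := by
    by_contra! hcon
    have hlow : ∀ N, (1 + ε) ^ N ≤ ((B N).card : ℝ) := by
      intro N
      induction N with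
      | zero => simpa using neB 0
      | succ N ih =>
        rw [pow_succ']
        exact (mul_le_mul_of_nonneg_left ih (by positivity)).trans (hcon N).le
    have hlim := (tendsto_pow_const_div_const_pow_of_one_lt S.card
      (show 1 < 1 + ε by linarith)).comp (tendsto_add_atTop_nat 1)
    have hpos : 0 < (1 + ε)⁻¹ := by positivity
    obtain ⟨N, hN⟩ := (hlim.eventually (gt_mem_nhds hpos)).exists
    have h1 : ((B N).card : ℝ) ≤ ((N + 1 : ℕ) : ℝ) ^ S.card := by exact_mod_cast cardB N
    have h2 := (hlow N).trans h1
    simp only [Function.comp_apply] at hN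
    rw [div_lt_iff₀ (by positivity), pow_succ, mul_comm _ (1 + ε), ← mul_assoc,
      inv_mul_cancel₀ (by positivity), one_mul] at hN
    linarith
  refine ⟨B N, neB N, fun g hg => ?_⟩
  have himg : ((B N).filter fun h => h - g ∉ B N).card + (B N).card ≤ (B (N + 1)).card := by
    rw [← Finset.card_image_of_injective (B N) (add_left_injective g),
      ← Finset.card_union_of_disjoint]
    · refine Finset.card_le_card (Finset.union_subset ?_ ?_)
      · exact (Finset.filter_subset _ _).trans (subB N)
      · intro x hx
        obtain ⟨y, hy, rfl⟩ := Finset.mem_image.1 hx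
        exact addB N g hg y hy
    · rw [Finset.disjoint_left]
      intro x hx hx'
      obtain ⟨y, hy, rfl⟩ := Finset.mem_image.1 hx'
      have := (Finset.mem_filter.1 hx).2
      simp [hy] at this
  have : (((B N).filter fun h => h - g ∉ B N).card : ℝ) + (B N).card ≤ (B (N + 1)).card := by
    exact_mod_cast himg
  linarith

/-! ### Positive semidefinite matrices -/

/-- The trace bound `|tr (ρA)| ≤ ‖A‖ tr ρ` for a positive operator `ρ` on the span of a finite
orthonormal family, with `P` the transposed matrix of `ρ`. -/
theorem norm_sum_mul_inner_le {E ι : Type*} [NormedAddCommGroup E] [InnerProductSpace ℂ E]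
    [Fintype ι] {e : ι → E} (he : Orthonormal ℂ e) {P : Matrix ι ι ℂ} (hP : P.PosSemidef)
    (A : E →L[ℂ] E) :
    ‖∑ i, ∑ j, P i j * inner ℂ (e i) (A (e j))‖ ≤ ‖A‖ * ∑ i, (P i i).re := by
  classical
  obtain ⟨B, rfl⟩ : ∃ B : Matrix ι ι ℂ, P = Bᴴ * B := by
    open scoped MatrixOrder Matrix.Norms.L2Operator in
    exact CStarAlgebra.nonneg_iff_eq_star_mul_self.mp hP.nonneg
  let β : ι → E := fun k => ∑ i, B k i • e i
  have h1 : ∑ i, ∑ j, (Bᴴ * B) i j * inner ℂ (e i) (A (e j)) =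
      ∑ k, inner ℂ (β k) (A (β k)) := by
    simp only [β, map_sum, map_smul, sum_inner, inner_sum, inner_smul_left, inner_smul_right,
      Matrix.mul_apply, Matrix.conjTranspose_apply, Finset.sum_mul]
    rw [Finset.sum_comm_cycle]
    refine Finset.sum_congr rfl fun k _ => ?_
    rw [Finset.sum_comm]
    refine Finset.sum_congr rfl fun i _ => ?_
    rw [Finset.mul_sum]
    refine Finset.sum_congr rfl fun j _ => ?_
    rw [Complex.star_def]
    ring
  have h2 : ∑ i, ((Bᴴ * B) i i).re = ∑ k, ‖β k‖ ^ 2 := by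
    have h3 : ∀ k, ‖β k‖ ^ 2 = ∑ i, ‖B k i‖ ^ 2 := fun k => by
      rw [← Complex.ofReal_inj, Complex.ofReal_pow]
      refine (inner_self_eq_norm_sq_to_K (𝕜 := ℂ) (β k)).symm.trans ?_
      simp only [β, he.inner_sum]
      simp [Complex.conj_mul']
    simp only [h3]
    rw [Finset.sum_comm]
    refine Finset.sum_congr rfl fun i _ => ?_
    simp only [Matrix.mul_apply, Matrix.conjTranspose_apply, Complex.re_sum, Complex.star_def,
      Complex.conj_mul']
    norm_cast
  rw [h1, h2, Finset.mul_sum]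
  refine (norm_sum_le _ _).trans (Finset.sum_le_sum fun k _ => ?_)
  calc _ ≤ ‖β k‖ * ‖A (β k)‖ := norm_inner_le_norm _ _
    _ ≤ ‖β k‖ * (‖A‖ * ‖β k‖) := by gcongr; exact A.le_opNorm _
    _ = _ := by ring

theorem posSemidef_rankOne {ι : Type*} (a : ι → ℂ) :
    (Matrix.of fun i j => conj (a i) * a j).PosSemidef := by
  refine ⟨?_, fun x => ?_⟩
  · ext i j
    simp [mul_comm]
  · have h : (x.sum fun i xi => x.sum fun j xj =>
        star xi * (Matrix.of fun i j => conj (a i) * a j) i j * xj) =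
        star (x.sum fun i xi => xi * a i) * x.sum fun i xi => xi * a i := by
      simp only [Finsupp.sum, star_sum, Finset.sum_mul_sum, star_mul', Matrix.of_apply,
        Complex.star_def]
      refine Finset.sum_congr rfl fun i _ => Finset.sum_congr rfl fun j _ => ?_
      ring
    rw [h]
    exact star_mul_self_nonneg _

/-- The entrywise exponential of a positive semidefinite matrix is positive semidefinite, by the
Schur product theorem applied to each term of the exponential series. -/
theorem posSemidef_exp {ι : Type*} {P : Matrix ι ι ℂ} (hP : P.PosSemidef) :
    (Matrix.of fun i j => Complex.exp (P i j)).PosSemidef := by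
  have hpow : ∀ n : ℕ, (Matrix.of fun i j => P i j ^ n).PosSemidef := by
    intro n
    induction n with
    | zero => simpa using posSemidef_rankOne (fun _ : ι => (1 : ℂ))
    | succ n ih =>
      have h : (Matrix.of fun i j => P i j ^ (n + 1)) = (Matrix.of fun i j => P i j ^ n) ⊙ P := by
        ext i j
        simp [pow_succ]
      rw [h]
      exact ih.hadamard hP
  refine ⟨?_, fun x => ?_⟩
  · ext i j
    simp [← Complex.exp_conj, ← hP.isHermitian.apply i j]
  · have hsum : HasSum (fun n : ℕ => ((n.factorial : ℂ))⁻¹ *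
        (x.sum fun i xi => x.sum fun j xj =>
          star xi * (Matrix.of fun i j => P i j ^ n) i j * xj))
        (x.sum fun i xi => x.sum fun j xj =>
          star xi * (Matrix.of fun i j => Complex.exp (P i j)) i j * xj) := by
      simp only [Finsupp.sum, Finset.mul_sum, Matrix.of_apply]
      refine hasSum_sum fun i _ => hasSum_sum fun j _ => ?_
      have := NormedSpace.expSeries_div_hasSum_exp (𝔸 := ℂ) (P i j)
      rw [← Complex.exp_eq_exp_ℂ] at this
      have h2 : (fun n : ℕ => ((n.factorial : ℂ))⁻¹ * (star (x i) * P i j ^ n * x j)) =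
          fun n : ℕ => star (x i) * (P i j ^ n / n.factorial) * x j := by
        funext n
        ring
      rw [h2]
      exact (this.mul_left _).mul_right _
    refine hsum.nonneg fun n => mul_nonneg ?_ ((hpow n).2 x)
    rw [← Complex.ofReal_natCast, ← Complex.ofReal_inv]
    exact Complex.zero_le_real.2 (by positivity)

variable {d : ℕ}

/-! ### Density of the Weyl operators -/

theorem dense_span_W : Dense (Submodule.span ℂ (Set.range (W (d := d))) : Set (CCR d)) := by
  let M : Submodule ℂ (Ell2 d →L[ℂ] Ell2 d) := Submodule.span ℂ (Set.range weylOp)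
  have hM : ∀ f, weylOp f ∈ M := fun f => Submodule.subset_span ⟨f, rfl⟩
  have hone : (1 : Ell2 d →L[ℂ] Ell2 d) ∈ M := by
    have h : weylOp (0 : Test d) = 1 := congrArg Subtype.val W_zero
    exact h ▸ hM 0
  have hadj : ∀ y ∈ StarAlgebra.adjoin ℂ (Set.range (weylOp (d := d))), y ∈ M := by
    intro y hy
    induction hy using StarAlgebra.adjoin_induction with
    | mem x hx => exact Submodule.subset_span hx
    | algebraMap r =>
      rw [Algebra.algebraMap_eq_smul_one]
      exact M.smul_mem r hone
    | add x y _ _ hx hy => exact M.add_mem hx hy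
    | mul x y _ _ hx hy =>
      have h := Submodule.mul_mem_mul hx hy
      rw [Submodule.span_mul_span] at h
      refine Submodule.span_le.2 ?_ h
      rintro _ ⟨_, ⟨f, rfl⟩, _, ⟨g, rfl⟩, rfl⟩
      have h2 : weylOp f * weylOp g = weylPhase f g • weylOp (f + g) :=
        congrArg Subtype.val (W_mul_W f g)
      change weylOp f * weylOp g ∈ M
      rw [h2]
      exact M.smul_mem _ (hM _)
    | star x hadj hx =>
      clear hadj
      induction hx using Submodule.span_induction with
      | mem x hx =>
        obtain ⟨f, rfl⟩ := hx
        have h2 : star (weylOp f) = weylOp (-f) := congrArg Subtype.val (star_W f)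
        exact h2 ▸ hM _
      | zero => simp
      | add x y _ _ hx hy => rw [star_add]; exact M.add_mem hx hy
      | smul c x _ hx => rw [star_smul]; exact M.smul_mem _ hx
  intro x
  rw [closure_subtype]
  refine closure_mono ?_ x.2
  intro y hy
  have h := hadj y hy
  have hW : Set.range (weylOp (d := d)) =
      (ccrAlgebra d).toSubalgebra.toSubmodule.subtype '' Set.range W := by
    rw [← Set.range_comp]
    rfl
  simp only [M] at h
  rw [hW, ← Submodule.map_span] at h
  exact h

/-- A closed property that is stable under linear combinations holds on the whole CCR algebra if it
holds for the Weyl operators. -/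
theorem ccr_induction {p : CCR d → Prop} (hW : ∀ f, p (W f))
    (hadd : ∀ a b, p a → p b → p (a + b)) (hsmul : ∀ (c : ℂ) a, p a → p (c • a))
    (hclosed : IsClosed {a | p a}) (a : CCR d) : p a := by
  refine hclosed.closure_subset_iff.2 ?_ (dense_span_W a)
  intro x hx
  induction hx using Submodule.span_induction with
  | mem x hx => obtain ⟨f, rfl⟩ := hx; exact hW f
  | zero => simpa using hsmul 0 _ (hW 0)
  | add x y _ _ hx hy => exact hadd x y hx hy
  | smul c x _ hx => exact hsmul c x hx

/-! ### Quasi-free automorphisms -/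

theorem memℓp_weightedPerm (T : Test d ≃ Test d) (χ : Test d → ℂ) (hχ : ∀ h, ‖χ h‖ = 1)
    (ψ : Ell2 d) : Memℓp (fun h => χ h * ψ (T h)) 2 := by
  have h2 : (0 : ℝ) < (2 : ENNReal).toReal := by norm_num
  refine (memℓp_gen_iff h2).2 ?_
  simp only [norm_mul, hχ, one_mul]
  exact T.summable_iff.mpr ((memℓp_gen_iff h2).1 (lp.memℓp ψ))

/-- The unitary `(Uψ)(h) = χ(h) ψ(T⁻¹h)` on `ℓ²(𝒟)`, for a permutation `T` of `𝒟` and a phase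
function `χ`. -/
def weightedPerm (T : Test d ≃ Test d) (χ : Test d → ℂ) (hχ : ∀ h, ‖χ h‖ = 1) :
    Ell2 d ≃ₗᵢ[ℂ] Ell2 d where
  toFun ψ := ⟨fun h => χ h * ψ (T.symm h), memℓp_weightedPerm T.symm χ hχ ψ⟩
  invFun ψ := ⟨fun h => conj (χ (T h)) * ψ (T h),
    memℓp_weightedPerm T (fun h => conj (χ (T h))) (fun h => by simp [hχ]) ψ⟩
  map_add' ψ φ := by ext h; exact mul_add _ _ _
  map_smul' c ψ := by ext h; simp [mul_left_comm]
  left_inv ψ := by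
    ext h
    change conj (χ (T h)) * (χ (T h) * ψ (T.symm (T h))) = ψ h
    rw [← mul_assoc, Complex.conj_mul', hχ, T.symm_apply_apply]
    simp
  right_inv ψ := by
    ext h
    change χ h * (conj (χ (T (T.symm h))) * ψ (T (T.symm h))) = ψ h
    rw [T.apply_symm_apply, ← mul_assoc, Complex.mul_conj', hχ]
    simp
  norm_map' ψ := by
    have h2 : (0 : ℝ) < (2 : ENNReal).toReal := by norm_num
    rw [lp.norm_eq_tsum_rpow h2, lp.norm_eq_tsum_rpow h2]
    congr 1
    change ∑' h, ‖χ h * ψ (T.symm h)‖ ^ (2 : ENNReal).toReal = _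
    simp only [norm_mul, hχ, one_mul]
    exact T.symm.tsum_eq (fun h => ‖ψ h‖ ^ (2 : ENNReal).toReal)

/-- A permutation of `𝒟` that is a symplectic group automorphism, weighted by a character `χ`,
implements the map `W(f) ↦ χ(Tf) W(Tf)` on `ℓ²(𝒟)`. -/
theorem weightedPerm_conj_weylOp (T : Test d ≃+ Test d)
    (hT : ∀ f g, (ip (T f) (T g)).im = (ip f g).im)
    (χ : Test d → ℂ) (hχ : ∀ h, ‖χ h‖ = 1) (hadd : ∀ f g, χ (f + g) = χ f * χ g) (f : Test d) :
    (weightedPerm T.toEquiv χ hχ).conjStarAlgEquiv (weylOp f) = χ (T f) • weylOp (T f) := by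
  ext ψ h
  change χ h * (weylPhase f (T.symm h) * (conj (χ (T (T.symm h - f))) * ψ (T (T.symm h - f)))) =
    χ (T f) * (weylPhase (T f) h * ψ (h - T f))
  have h1 : weylPhase (T f) h = weylPhase f (T.symm h) := by
    rw [weylPhase, weylPhase, ← hT f, T.apply_symm_apply]
  have h2 : χ h = χ (h - T f) * χ (T f) := by rw [← hadd, sub_add_cancel]
  have h3 : χ (h - T f) * conj (χ (h - T f)) = 1 := by
    rw [Complex.mul_conj', hχ]; simp
  rw [map_sub, T.apply_symm_apply, h1, h2]
  linear_combination (χ (T f) * weylPhase f (T.symm h) * ψ (h - T f)) * h3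

theorem exists_weylHom (T : Test d ≃+ Test d) (hT : ∀ f g, (ip (T f) (T g)).im = (ip f g).im)
    (χ : Test d → ℂ) (hχ : ∀ h, ‖χ h‖ = 1) (hadd : ∀ f g, χ (f + g) = χ f * χ g) :
    ∃ α : CCR d →⋆ₐ[ℂ] CCR d, Isometry α ∧ ∀ f, α (W f) = χ (T f) • W (T f) := by
  let e := weightedPerm T.toEquiv χ hχ
  let E : (Ell2 d →L[ℂ] Ell2 d) →⋆ₐ[ℂ] (Ell2 d →L[ℂ] Ell2 d) := e.conjStarAlgEquiv.toStarAlgHom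
  have hE : Isometry E := by
    refine AddMonoidHomClass.isometry_of_norm E fun x => ?_
    exact (ContinuousLinearMap.opNorm_linearIsometryEquiv_comp e _).trans
      (ContinuousLinearMap.opNorm_comp_linearIsometryEquiv x e.symm)
  have hmem : ∀ x ∈ ccrAlgebra d, E x ∈ ccrAlgebra d := by
    have h : ccrAlgebra d ≤ (ccrAlgebra d).comap E := by
      refine StarSubalgebra.topologicalClosure_minimal (StarAlgebra.adjoin_le ?_)
        ((StarSubalgebra.isClosed_topologicalClosure _).preimage hE.continuous)
      rintro _ ⟨f, rfl⟩
      change e.conjStarAlgEquiv (weylOp f) ∈ ccrAlgebra d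
      rw [weightedPerm_conj_weylOp T hT χ hχ hadd]
      exact (ccrAlgebra d).smul_mem (W (T f)).2 _
    exact h
  refine ⟨(E.comp (ccrAlgebra d).subtype).codRestrict (ccrAlgebra d) fun x => hmem x x.2,
    hE.comp isometry_subtype_coe, fun f => Subtype.ext ?_⟩
  exact weightedPerm_conj_weylOp T hT χ hχ hadd f

/-- A symplectic automorphism `T` of the group `𝒟` and a character `χ` define the isometric
*-automorphism `W(f) ↦ χ(f) W(Tf)` of the CCR algebra. -/
theorem exists_weylAut (T : Test d ≃+ Test d) (hT : ∀ f g, (ip (T f) (T g)).im = (ip f g).im)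
    (χ : Test d → ℂ) (hχ : ∀ h, ‖χ h‖ = 1) (hadd : ∀ f g, χ (f + g) = χ f * χ g) :
    ∃ α : CCR d ≃⋆ₐ[ℂ] CCR d, Isometry α ∧ ∀ f, α (W f) = χ f • W (T f) := by
  obtain ⟨α, hα, hαW⟩ := exists_weylHom T hT (fun f => χ (T.symm f)) (fun _ => hχ _)
    (fun f g => by rw [map_add, hadd])
  obtain ⟨β, hβ, hβW⟩ := exists_weylHom T.symm
    (fun f g => by rw [← hT, T.apply_symm_apply, T.apply_symm_apply])
    (fun f => conj (χ f)) (fun h => by simp [hχ]) (fun f g => by rw [hadd, map_mul])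
  have hχ' : ∀ f, conj (χ f) * χ f = 1 := fun f => by rw [Complex.conj_mul', hχ]; simp
  simp only [T.symm_apply_apply] at hαW
  have hβα : ∀ a, β (α a) = a := by
    refine ccr_induction (fun f => ?_) (fun a b ha hb => by rw [map_add, map_add, ha, hb])
      (fun c a ha => by rw [map_smul, map_smul, ha])
      (isClosed_eq (hβ.continuous.comp hα.continuous) continuous_id)
    rw [hαW, map_smul, hβW, T.symm_apply_apply, smul_smul, mul_comm, hχ', one_smul]
  have hαβ : ∀ a, α (β a) = a := by
    refine ccr_induction (fun f => ?_) (fun a b ha hb => by rw [map_add, map_add, ha, hb])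
      (fun c a ha => by rw [map_smul, map_smul, ha])
      (isClosed_eq (hα.continuous.comp hβ.continuous) continuous_id)
    rw [hβW, map_smul, hαW, T.apply_symm_apply, smul_smul, hχ', one_smul]
  exact ⟨StarAlgEquiv.ofStarAlgHom α β (StarAlgHom.ext hβα) (StarAlgHom.ext hαβ), hα, hαW⟩

/-! ### States with prescribed values on the Weyl operators -/

/-- The kernel `(f, g) ↦ ω(W(f)* W(g)) = e^{iπ² Im⟨f,g⟩} Φ(g - f)` that a functional `ω` with
`ω(W(f)) = Φ(f)` would have. -/
def twistedKernel (Φ : Test d → ℂ) : Matrix (Test d) (Test d) ℂ :=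
  Matrix.of fun f g => weylPhase (-f) g * Φ (g - f)

theorem weylPhase_self_neg (f : Test d) : weylPhase f (-f) = 1 := by
  rw [weylPhase, ip_im_comm, ip_neg_left, Complex.neg_im, ip_self_im]
  simp

theorem weylPhase_mul_weylPhase_sub (g h : Test d) :
    weylPhase h (g - h) * weylPhase g h = 1 := by
  have h1 : (ip h (g - h)).im = - (ip g h).im := by
    rw [sub_eq_add_neg, ip_add_right, ip_im_comm g h, Complex.add_im, ip_im_comm h (-h),
      ip_neg_left, Complex.neg_im, ip_self_im]
    ring
  rw [weylPhase, weylPhase, ← Complex.exp_add, h1]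
  simp

open scoped Classical in
theorem orthonormal_single : Orthonormal ℂ fun h : Test d => (lp.single 2 h 1 : Ell2 d) := by
  rw [orthonormal_iff_ite]
  intro f g
  rw [lp.inner_single_left, lp.single_apply, Pi.single_apply]
  split_ifs <;> simp

/-- A function whose twisted kernel is positive semidefinite is bounded by the operator norm on
`ℓ²(𝒟)`: `|∑ x_g Φ(g)| ≤ ‖∑ x_g W(g)‖`. For a finite set `F` that is almost invariant under the
support of `x`, the matrix `P(h, h') = e^{-iπ² Im⟨h,-h'⟩} Φ(h - h')` on `F × F` is the transpose of
`#F` times a density matrix, in which `W(g)` has the expectation `Φ(g) #{h ∈ F : h - g ∈ F} / #F`,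
close to `Φ(g)`. -/
theorem norm_linearCombination_le {Φ : Test d → ℂ} (h0 : Φ 0 = 1)
    (hΦ : (twistedKernel Φ).PosSemidef) (x : Test d →₀ ℂ) :
    ‖Finsupp.linearCombination ℂ Φ x‖ ≤ ‖Finsupp.linearCombination ℂ (W (d := d)) x‖ := by
  classical
  set L := Finsupp.linearCombination ℂ (W (d := d)) x with hL
  let C : ℝ := ∑ g ∈ x.support, ‖x g * Φ g‖
  have key : ∀ ε > 0, ‖Finsupp.linearCombination ℂ Φ x‖ ≤ ‖L‖ + C * ε := by
    intro ε hε
    obtain ⟨F, hF, hS⟩ := exists_foelner x.support hε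
    have hFpos : (0 : ℝ) < F.card := by exact_mod_cast hF.card_pos
    let e : F → Ell2 d := fun h => lp.single 2 (h : Test d) 1
    have he : Orthonormal ℂ e := orthonormal_single.comp _ Subtype.val_injective
    -- the kernel is taken at the points `-h`, so that its phases cancel those of `W(g) δ_h`
    let P : Matrix F F ℂ :=
      (twistedKernel Φ).submatrix (fun h => -(h : Test d)) fun h => -(h : Test d)
    have hP : P.PosSemidef := hΦ.submatrix _
    have hPe : ∀ h h' : F, P h h' = weylPhase (h : Test d) (-h') * Φ (h - h') := by
      intro h h'
      simp [P, twistedKernel, neg_add_eq_sub]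
    have hin : ∀ (g : Test d) (h h' : F), inner ℂ (e h) (weylOp g (e h')) =
        if (h : Test d) - g = h' then weylPhase g h else 0 := by
      intro g h h'
      simp only [e]
      rw [lp.inner_single_left, weylOp_apply, lp.single_apply, Pi.single_apply]
      simp [eq_comm]
    let n : Test d → ℕ := fun g => (F.filter fun h => h - g ∈ F).card
    have hW : ∀ g, ∑ h, ∑ h', P h h' * inner ℂ (e h) (weylOp g (e h')) = n g * Φ g := by
      intro g
      have hrow : ∀ h : F, ∑ h', P h h' * inner ℂ (e h) (weylOp g (e h')) =
          if (h : Test d) - g ∈ F then Φ g else 0 := by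
        intro h
        simp only [hin, mul_ite, mul_zero]
        split_ifs with hm
        · rw [Finset.sum_eq_single ⟨(h : Test d) - g, hm⟩]
          · rw [if_pos rfl, hPe, neg_sub, sub_sub_cancel, mul_right_comm,
              weylPhase_mul_weylPhase_sub, one_mul]
          · intro b _ hb
            rw [if_neg]
            exact fun h' => hb (Subtype.ext h'.symm)
          · simp
        · refine Finset.sum_eq_zero fun b _ => if_neg fun h' => hm (by rw [h']; exact b.2)
      simp only [hrow]
      rw [Finset.sum_coe_sort F (fun h => if h - g ∈ F then Φ g else 0), ← Finset.sum_filter]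
      simp [n]
    have hbound := norm_sum_mul_inner_le he hP (L : Ell2 d →L[ℂ] Ell2 d)
    have hsumL : ∑ h, ∑ h', P h h' * inner ℂ (e h) ((L : Ell2 d →L[ℂ] Ell2 d) (e h')) =
        ∑ g ∈ x.support, x g * (n g * Φ g) := by
      have hLc : (L : Ell2 d →L[ℂ] Ell2 d) = ∑ g ∈ x.support, x g • weylOp g := by
        rw [hL, Finsupp.linearCombination_apply, Finsupp.sum]
        simp [W]
      simp only [← hW, hLc, sum_apply, smul_apply,
        inner_sum, inner_smul_right, Finset.mul_sum]
      rw [Finset.sum_comm_cycle]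
      refine Finset.sum_congr rfl fun g _ => Finset.sum_congr rfl fun h _ =>
        Finset.sum_congr rfl fun h' _ => ?_
      ring
    have htr : ∑ i, (P i i).re = F.card := by
      simp [hPe, weylPhase_self_neg, h0]
    rw [hsumL, htr] at hbound
    have hsplit : Finsupp.linearCombination ℂ Φ x * F.card =
        ∑ g ∈ x.support, x g * (n g * Φ g) +
        ∑ g ∈ x.support, x g * Φ g * ((F.filter fun h => h - g ∉ F).card : ℂ) := by
      rw [Finsupp.linearCombination_apply, Finsupp.sum, Finset.sum_mul, ← Finset.sum_add_distrib]
      refine Finset.sum_congr rfl fun g _ => ?_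
      have : (F.card : ℂ) = n g + ((F.filter fun h => h - g ∉ F).card : ℂ) := by
        rw [← F.card_filter_add_card_filter_not (fun h => h - g ∈ F)]
        push_cast
        rfl
      rw [this, smul_eq_mul]
      ring
    have herr : ‖∑ g ∈ x.support, x g * Φ g * ((F.filter fun h => h - g ∉ F).card : ℂ)‖ ≤
        C * ε * F.card := by
      refine (norm_sum_le _ _).trans ?_
      simp only [C, Finset.sum_mul]
      refine Finset.sum_le_sum fun g hg => ?_
      rw [norm_mul, Complex.norm_natCast, mul_assoc]
      exact mul_le_mul_of_nonneg_left (hS g hg) (norm_nonneg _)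
    have hfin : ‖Finsupp.linearCombination ℂ Φ x‖ * F.card ≤ (‖L‖ + C * ε) * F.card := by
      rw [← Complex.norm_natCast, ← norm_mul, hsplit, Complex.norm_natCast, add_mul]
      exact (norm_add_le _ _).trans (add_le_add hbound herr)
    exact le_of_mul_le_mul_right hfin hFpos
  have hlim : Tendsto (fun ε : ℝ => ‖L‖ + C * ε) (𝓝[>] 0) (𝓝 (‖L‖ + C * 0)) :=
    ((continuous_const.add (continuous_const.mul continuous_id)).tendsto 0).mono_left
      nhdsWithin_le_nhds
  rw [mul_zero, add_zero] at hlim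
  exact ge_of_tendsto hlim (eventually_nhdsWithin_of_forall key)

/-- A normalised function on `𝒟` with positive semidefinite twisted kernel is the restriction of a
state of the CCR algebra to the Weyl operators. -/
theorem exists_state {Φ : Test d → ℂ} (h0 : Φ 0 = 1) (hΦ : (twistedKernel Φ).PosSemidef) :
    ∃ ω : CCR d →L[ℂ] ℂ, IsState ω ∧ ∀ f, ω (W f) = Φ f := by
  have hdense : DenseRange (Finsupp.linearCombination ℂ (W (d := d))) := by
    have h := dense_span_W (d := d)
    rwa [← Finsupp.range_linearCombination] at h
  obtain ⟨ω, hω⟩ : ∃ ω : CCR d →L[ℂ] ℂ, ∀ x,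
      ω (Finsupp.linearCombination ℂ W x) = Finsupp.linearCombination ℂ Φ x :=
    ⟨_, LinearMap.extendOfNorm_eq hdense ⟨1, fun x => by
      rw [one_mul]; exact norm_linearCombination_le h0 hΦ x⟩⟩
  have hωW : ∀ f, ω (W f) = Φ f := fun f => by
    simpa using hω (Finsupp.single f 1)
  have hpos : ∀ a, 0 ≤ ω (star a * a) := by
    refine fun a => hdense.induction_on (p := fun a => 0 ≤ ω (star a * a)) a ?_ fun x => ?_
    · exact isClosed_le continuous_const (by fun_prop)
    · have hfg : ∀ f g, ω (star (x f • W f) * (x g • W g)) =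
          star (x f) * twistedKernel Φ f g * x g := fun f g => by
        rw [star_smul, star_W, smul_mul_smul_comm, W_mul_W, map_smul, map_smul, hωW,
          neg_add_eq_sub, twistedKernel, Matrix.of_apply, smul_eq_mul, smul_eq_mul]
        ring
      have hx : ω (star (Finsupp.linearCombination ℂ W x) * Finsupp.linearCombination ℂ W x) =
          x.sum fun f xf => x.sum fun g xg => star xf * twistedKernel Φ f g * xg := by
        rw [Finsupp.linearCombination_apply, Finsupp.sum, star_sum, Finset.sum_mul_sum, map_sum]
        refine Finset.sum_congr rfl fun f _ => ?_
        rw [map_sum]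
        exact Finset.sum_congr rfl fun g _ => hfg f g
      rw [hx]
      exact hΦ.2 x
  refine ⟨ω, ⟨by rw [← W_zero, hωW, h0], fun a => ?_⟩, hωW⟩
  have := Complex.nonneg_iff.1 (hpos a)
  exact ⟨this.1, this.2.symm⟩

/-! ### Coherent states -/

theorem ip_smul_right (c : ℂ) (f g : Test d) : ip f (c • g) = c * ip f g := by
  simp only [ip, ← integral_const_mul]
  congr 1
  ext k
  change conj (f k) * (c * g k) = _
  ring

theorem ip_smul_left (c : ℂ) (f g : Test d) : ip (c • f) g = conj c * ip f g := by
  rw [← conj_ip, ip_smul_right, map_mul, conj_ip]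

theorem ip_self_eq (f : Test d) : ip f f = ((∫ k, ‖f k‖ ^ 2 : ℝ) : ℂ) := by
  rw [ip, ← integral_complex_ofReal]
  simp [Complex.conj_mul']

theorem posSemidef_ip : (Matrix.of fun f g : Test d => ip f g).PosSemidef := by
  refine ⟨?_, fun x => ?_⟩
  · ext f g
    exact conj_ip g f
  · have hr : ∀ (f : Test d) (s : Finset (Test d)) (u : Test d → Test d),
        ip f (∑ g ∈ s, u g) = ∑ g ∈ s, ip f (u g) := fun f s u =>
      map_sum (AddMonoidHom.mk' (ip f) (ip_add_right f)) u s
    have hl : ∀ (f : Test d) (s : Finset (Test d)) (u : Test d → Test d),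
        ip (∑ g ∈ s, u g) f = ∑ g ∈ s, ip (u g) f := fun f s u =>
      map_sum (AddMonoidHom.mk' (fun g => ip g f) fun a b => ip_add_left a b f) u s
    have h : (x.sum fun f xf => x.sum fun g xg =>
        star xf * (Matrix.of fun f g : Test d => ip f g) f g * xg) =
        ip (∑ f ∈ x.support, x f • f) (∑ f ∈ x.support, x f • f) := by
      simp only [hl, hr, ip_smul_left, ip_smul_right, Finsupp.sum, Matrix.of_apply,
        Complex.star_def]
      refine Finset.sum_congr rfl fun i _ => Finset.sum_congr rfl fun j _ => ?_
      ring
    rw [h, ip_self_eq]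
    exact Complex.zero_le_real.2 (integral_nonneg fun k => by positivity)

theorem bracket_add_left (f g : Test d) (T : Distr d) :
    bracket (f + g) T = bracket f T + bracket g T := by
  simp [bracket]

theorem bracket_smul_real (s : ℝ) (f : Test d) (T : Distr d) :
    bracket (s • f) T = s * bracket f T := by
  have h : conjTest (s • f) = (s : ℂ) • conjTest f := by
    ext k
    rw [conjTest_apply]
    change conj (s • f k) = (s : ℂ) * conj (f k)
    simp
  rw [bracket, h, map_smul, smul_eq_mul, bracket]

/-- The value `e^{-(π²/2)⟨f,f⟩} e^{2πi Re⟨f,T⟩}` on `W(f)` of the coherent state centred at `T`. -/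
def coherentValue (T : Distr d) (f : Test d) : ℂ :=
  Complex.exp (-(Real.pi ^ 2 / 2) * ip f f) *
    Complex.exp (2 * Real.pi * Complex.I * (bracket f T).re)

/-- The twisted kernel of the coherent state is `conj Φ(f) · e^{π²⟨f,g⟩} · Φ(g)`, the exponential of
a Gram matrix conjugated by a diagonal matrix. -/
theorem posSemidef_coherentValue (T : Distr d) : (twistedKernel (coherentValue T)).PosSemidef := by
  have h1 : (Matrix.of fun f g : Test d => Complex.exp ((Real.pi ^ 2 : ℝ) * ip f g)).PosSemidef :=
    posSemidef_exp (posSemidef_ip.smul (α := ℂ) (a := ((Real.pi ^ 2 : ℝ) : ℂ))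
      (Complex.zero_le_real.2 (by positivity)))
  have h2 := (posSemidef_rankOne (coherentValue T)).hadamard h1
  have h3 : twistedKernel (coherentValue T) =
      (Matrix.of fun f g => conj (coherentValue T f) * coherentValue T g) ⊙
        Matrix.of fun f g : Test d => Complex.exp ((Real.pi ^ 2 : ℝ) * ip f g) := by
    refine Matrix.ext fun f g => ?_
    have hb : (bracket (g - f) T).re = (bracket g T).re - (bracket f T).re := by
      have := congrArg Complex.re (bracket_add_left (g - f) f T)
      rw [sub_add_cancel, Complex.add_re] at this
      linarith
    have hneg : ∀ f g : Test d, ip f (-g) = -ip f g := fun f g => by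
      rw [← conj_ip, ip_neg_left, map_neg, conj_ip]
    have hip : ip (g - f) (g - f) = ip g g - ip g f - ip f g + ip f f := by
      simp only [sub_eq_add_neg, ip_add_left, ip_add_right, ip_neg_left, hneg]
      ring
    have him : ((ip f g).im : ℂ) * Complex.I = (ip f g - ip g f) / 2 := by
      rw [← conj_ip f g, Complex.sub_conj]
      push_cast
      ring
    have hconj : conj (-(Real.pi ^ 2 / 2 : ℂ) * ip f f +
        2 * Real.pi * Complex.I * (bracket f T).re) =
        -(Real.pi ^ 2 / 2 : ℂ) * ip f f - 2 * Real.pi * Complex.I * (bracket f T).re := by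
      have h2c : conj (2 : ℂ) = 2 := map_ofNat _ 2
      simp [conj_ip, h2c]
      ring
    simp only [twistedKernel, coherentValue, Matrix.of_apply, Matrix.hadamard_apply, weylPhase,
      ← Complex.exp_add, ← Complex.exp_conj, hconj, hb, hip, ip_neg_left, Complex.neg_im]
    congr 1
    push_cast
    linear_combination (Real.pi : ℂ) ^ 2 * him
  exact h3 ▸ h2

theorem existsUnique_coherentState (T : Distr d) : ∃! ω : CCR d →L[ℂ] ℂ, IsCoherentState T ω := by
  obtain ⟨ω, hω, hωW⟩ := exists_state (Φ := coherentValue T)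
    (by simp [coherentValue, ip, bracket]) (posSemidef_coherentValue T)
  refine ⟨ω, ⟨hω, fun f => ?_, hωW⟩, fun ω' h' => ?_⟩
  · simp only [hωW, coherentValue, bracket_smul_real]
    have h : ∀ s : ℝ, ip (s • f) (s • f) = (s : ℂ) ^ 2 * ip f f := fun s => by
      have hs : s • f = (s : ℂ) • f := by
        ext k
        change s • f k = (s : ℂ) * f k
        simp
      rw [hs, ip_smul_left, ip_smul_right, Complex.conj_ofReal]
      ring
    simp only [h, Complex.re_ofReal_mul]
    fun_prop
  · ext a
    exact ccr_induction (p := fun a => ω' a = ω a) (fun f => (h'.apply_W f).trans (hωW f).symm)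
      (fun a b ha hb => by rw [map_add, map_add, ha, hb])
      (fun c a ha => by rw [map_smul, map_smul, ha])
      (isClosed_eq ω'.continuous ω.continuous) a

/-! ### The van Hove-Miyatake dynamics -/

namespace Dispersion

variable (ϖ : Dispersion d)

theorem evol_apply (t : ℝ) (f : Test d) (k : Mom d) :
    ϖ.evol t f k = Complex.exp (Complex.I * t * ϖ.toFun k) * f k := rfl

theorem evol_evol (s t : ℝ) (f : Test d) : ϖ.evol s (ϖ.evol t f) = ϖ.evol (s + t) f := by
  ext k
  simp only [evol_apply]
  rw [← mul_assoc, ← Complex.exp_add]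
  push_cast
  ring_nf

theorem evol_zero (f : Test d) : ϖ.evol 0 f = f := by
  ext k
  simp [evol_apply]

theorem norm_exp_evol (t : ℝ) (k : Mom d) :
    ‖Complex.exp (Complex.I * t * ϖ.toFun k)‖ = 1 := by
  rw [Complex.norm_exp]
  simp

theorem ip_evol_evol (t : ℝ) (f g : Test d) : ip (ϖ.evol t f) (ϖ.evol t g) = ip f g := by
  rw [ip, ip]
  congr 1
  funext k
  have h : conj (Complex.exp (Complex.I * t * ϖ.toFun k)) *
      Complex.exp (Complex.I * t * ϖ.toFun k) = 1 := by
    rw [Complex.conj_mul', norm_exp_evol]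
    simp
  rw [evol_apply, evol_apply, map_mul]
  linear_combination (conj (f k) * g k) * h

theorem bracket_evolDistr (t : ℝ) (f : Test d) (T : Distr d) :
    bracket f (ϖ.evolDistr (-t) T) = bracket (ϖ.evol t f) T := by
  change T (ϖ.evol (-t) (conjTest f)) = T (conjTest (ϖ.evol t f))
  congr 1
  ext k
  rw [evol_apply, conjTest_apply, conjTest_apply, evol_apply, map_mul, ← Complex.exp_conj]
  simp

/-- The operator `e^{itϖ}` as an automorphism of the additive group `𝒟`. -/
def evolEquiv (t : ℝ) : Test d ≃+ Test d where
  toFun := ϖ.evol t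
  invFun := ϖ.evol (-t)
  left_inv f := by rw [evol_evol, neg_add_cancel, evol_zero]
  right_inv f := by rw [evol_evol, add_neg_cancel, evol_zero]
  map_add' := map_add _

/-- The phase `e^{2πi Re⟨f, (e^{-itϖ} - 1)T⟩}`, with `e^{-itϖ}` moved to the test function. -/
def vanHovePhase (T : Distr d) (t : ℝ) (f : Test d) : ℂ :=
  Complex.exp (2 * Real.pi * Complex.I * ((bracket (ϖ.evol t f) T).re - (bracket f T).re : ℝ))

theorem vanHovePhase_eq (T : Distr d) (t : ℝ) (f : Test d) :
    Complex.exp (2 * Real.pi * Complex.I * (bracket f (ϖ.evolDistr (-t) T - T)).re) =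
      ϖ.vanHovePhase T t f := by
  have h : bracket f (ϖ.evolDistr (-t) T - T) = bracket (ϖ.evol t f) T - bracket f T := by
    rw [← bracket_evolDistr]
    rfl
  rw [h, Complex.sub_re, vanHovePhase]

theorem norm_vanHovePhase (T : Distr d) (t : ℝ) (f : Test d) : ‖ϖ.vanHovePhase T t f‖ = 1 := by
  rw [vanHovePhase, Complex.norm_exp]
  simp

theorem vanHovePhase_add_right (T : Distr d) (t : ℝ) (f g : Test d) :
    ϖ.vanHovePhase T t (f + g) = ϖ.vanHovePhase T t f * ϖ.vanHovePhase T t g := by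
  simp only [vanHovePhase, ← Complex.exp_add, map_add, bracket_add_left, Complex.add_re]
  push_cast
  ring_nf

/-- The cocycle identity behind the group law of the dynamical map. -/
theorem vanHovePhase_add_left (T : Distr d) (s t : ℝ) (f : Test d) :
    ϖ.vanHovePhase T (s + t) f = ϖ.vanHovePhase T t f * ϖ.vanHovePhase T s (ϖ.evol t f) := by
  simp only [vanHovePhase, ← Complex.exp_add, evol_evol]
  push_cast
  ring_nf

theorem vanHovePhase_zero (T : Distr d) (f : Test d) : ϖ.vanHovePhase T 0 f = 1 := by
  simp [vanHovePhase, evol_zero]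

end Dispersion

theorem existsUnique_dynamicalMap (ϖ : Dispersion d) (v : Distr d) :
    ∃! τ : ℝ → (CCR d ≃⋆ₐ[ℂ] CCR d), IsDynamicalMap ϖ v τ := by
  have h : ∀ t, ∃ α : CCR d ≃⋆ₐ[ℂ] CCR d, Isometry α ∧
      ∀ f, α (W f) = ϖ.vanHovePhase (ϖ.divDistr v) t f • W (ϖ.evol t f) := fun t =>
    exists_weylAut (ϖ.evolEquiv t) (fun f g => congrArg Complex.im (ϖ.ip_evol_evol t f g)) _
      (ϖ.norm_vanHovePhase _ t) (ϖ.vanHovePhase_add_right _ t)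
  choose τ hτ hτW using h
  refine ⟨τ, ⟨fun a => ?_, fun s t a => ?_, hτ, fun t f => ?_⟩, fun τ' h' => ?_⟩
  · refine ccr_induction (p := fun a => τ 0 a = a) (fun f => ?_)
      (fun a b ha hb => by rw [map_add, ha, hb]) (fun c a ha => by rw [map_smul, ha])
      (isClosed_eq (hτ 0).continuous continuous_id) a
    rw [hτW, ϖ.vanHovePhase_zero, ϖ.evol_zero, one_smul]
  · refine ccr_induction (p := fun a => τ (s + t) a = τ s (τ t a)) (fun f => ?_)
      (fun a b ha hb => by rw [map_add, map_add, map_add, ha, hb])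
      (fun c a ha => by rw [map_smul, map_smul, map_smul, ha])
      (isClosed_eq (hτ _).continuous ((hτ s).continuous.comp (hτ t).continuous)) a
    rw [hτW, hτW, map_smul, hτW, ϖ.evol_evol, smul_smul, ϖ.vanHovePhase_add_left]
  · rw [hτW, ϖ.vanHovePhase_eq]
  · funext t
    ext a : 1
    refine ccr_induction (p := fun a => τ' t a = τ t a) (fun f => ?_)
      (fun a b ha hb => by rw [map_add, map_add, ha, hb])
      (fun c a ha => by rw [map_smul, map_smul, ha])
      (isClosed_eq (h'.isometry t).continuous (hτ t).continuous) a
    rw [h'.map_W, hτW, ϖ.vanHovePhase_eq]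

/-! ### Spectral condition -/

/-- An integrable function whose Fourier transform `λ ↦ ∫ F(t) e^{itλ} dt` vanishes on `[0, ∞)`. -/
structure IsNegFreq (F : ℝ → ℂ) : Prop where
  integrable : Integrable F
  integral_eq_zero : ∀ l : ℝ, 0 ≤ l → ∫ t : ℝ, Complex.exp (Complex.I * t * l) * F t = 0

theorem IsNegFreq.exp_mul {F : ℝ → ℂ} (hF : IsNegFreq F) {l : ℝ} (hl : 0 ≤ l) :
    IsNegFreq fun t => Complex.exp (Complex.I * t * l) * F t := by
  refine ⟨hF.integrable.bdd_mul (c := 1) (Continuous.aestronglyMeasurable (by fun_prop))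
    (ae_of_all _ fun t => ?_), fun l' hl' => ?_⟩
  · rw [Complex.norm_exp]
    simp
  · rw [← hF.integral_eq_zero (l' + l) (add_nonneg hl' hl)]
    congr 1
    funext t
    rw [← mul_assoc, ← Complex.exp_add]
    push_cast
    ring_nf

/-- Fourier inversion: `∫ F(t) e^{itλ} dt = φ(λ / 2π)`, which vanishes for `λ ≥ 0`. -/
theorem isNegFreq_invFourier (φ : 𝓓((⟨Set.Iio 0, isOpen_Iio⟩ : Opens ℝ), ℂ)) :
    IsNegFreq (invFourier φ) := by
  let ψ : SchwartzMap ℝ ℂ := φ.hasCompactSupport.toSchwartzMap φ.contDiff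
  have hF : invFourier φ = FourierTransform.fourier ψ := by
    funext t
    rw [SchwartzMap.fourier_coe, Real.fourier_real_eq_integral_exp_smul, invFourier]
    congr 1
    funext p
    change φ p * _ = _ • φ p
    rw [smul_eq_mul, mul_comm]
    congr 2
    push_cast
    ring
  rw [hF]
  refine ⟨(FourierTransform.fourier ψ).integrable, fun l hl => ?_⟩
  have hinv : FourierTransformInv.fourierInv (FourierTransform.fourier ψ) = ψ :=
    FourierTransform.fourierInv_fourier_eq ψ
  have h1 := congrArg (fun u : SchwartzMap ℝ ℂ => u (l / (2 * Real.pi))) hinv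
  have h2 : ψ (l / (2 * Real.pi)) = 0 := by
    change φ (l / (2 * Real.pi)) = 0
    refine image_eq_zero_of_notMem_tsupport fun hmem => ?_
    have h3 : l / (2 * Real.pi) < 0 := φ.tsupport_subset hmem
    exact absurd h3 (not_lt.2 (by positivity))
  simp only [h2, SchwartzMap.fourierInv_coe, Real.fourierInv_eq'] at h1
  rw [← h1]
  congr 1
  funext t
  rw [smul_eq_mul]
  congr 2
  have : (Real.pi : ℂ) ≠ 0 := by exact_mod_cast Real.pi_ne_zero
  simp
  field_simp

theorem norm_ip_evol_le (ϖ : Dispersion d) (f g : Test d) (t : ℝ) :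
    ‖ip f (ϖ.evol t g)‖ ≤ ∫ k, ‖conj (f k) * g k‖ := by
  refine (norm_integral_le_integral_norm _).trans (le_of_eq ?_)
  congr 1
  funext k
  rw [ϖ.evol_apply, norm_mul, norm_mul, norm_mul, ϖ.norm_exp_evol, one_mul]

theorem continuous_ip_evol (ϖ : Dispersion d) (f g : Test d) :
    Continuous fun t => ip f (ϖ.evol t g) := by
  refine continuous_of_dominated (bound := fun k => ‖conj (f k) * g k‖)
    (fun t => (integrable_conj_mul f _).aestronglyMeasurable) (fun t => ae_of_all _ fun k => ?_)
    (integrable_conj_mul f g).norm (ae_of_all _ fun k => ?_)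
  · rw [ϖ.evol_apply, norm_mul, norm_mul, norm_mul, ϖ.norm_exp_evol, one_mul]
  · simp only [ϖ.evol_apply]
    fun_prop

/-- The powers of `⟨f, e^{itϖ}g⟩ = ∫ f̄ g e^{itϖ}` have no negative frequencies. Each factor, by
Fubini's theorem, is absorbed into `F`, because `F(t) e^{itϖ(k)}` is again of negative frequency as
`ϖ ≥ 0`. -/
theorem IsNegFreq.integral_mul_ip_pow (ϖ : Dispersion d) (f g : Test d) (n : ℕ) :
    ∀ {F : ℝ → ℂ}, IsNegFreq F → ∫ t : ℝ, F t * ip f (ϖ.evol t g) ^ n = 0 := by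
  induction n with
  | zero =>
    intro F hF
    simpa using hF.integral_eq_zero 0 le_rfl
  | succ n ih =>
    intro F hF
    have hG := continuous_ip_evol ϖ f g
    have hFG : Integrable fun t => F t * ip f (ϖ.evol t g) ^ n :=
      hF.integrable.mul_bdd (c := (∫ k, ‖conj (f k) * g k‖) ^ n)
        (hG.pow n).aestronglyMeasurable (ae_of_all _ fun t => by
          rw [norm_pow]
          exact pow_le_pow_left₀ (norm_nonneg _) (norm_ip_evol_le ϖ f g t) n)
    have hϖ : Continuous ϖ.toFun := ϖ.smooth.continuous
    have hint : Integrable (Function.uncurry fun (t : ℝ) (k : Mom d) =>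
        Complex.exp (Complex.I * t * ϖ.toFun k) *
          ((F t * ip f (ϖ.evol t g) ^ n) * (conj (f k) * g k))) (volume.prod volume) := by
      refine (hFG.mul_prod (integrable_conj_mul f g)).bdd_mul (c := 1)
        (Continuous.aestronglyMeasurable (by fun_prop)) (ae_of_all _ fun z => ?_)
      rw [ϖ.norm_exp_evol]
    calc ∫ t : ℝ, F t * ip f (ϖ.evol t g) ^ (n + 1)
        = ∫ t : ℝ, ∫ k, Complex.exp (Complex.I * t * ϖ.toFun k) *
            ((F t * ip f (ϖ.evol t g) ^ n) * (conj (f k) * g k)) := by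
          congr 1
          funext t
          rw [pow_succ, ← mul_assoc]
          nth_rewrite 2 [ip]
          rw [← integral_const_mul]
          congr 1
          funext k
          rw [ϖ.evol_apply]
          ring
      _ = ∫ k, ∫ t : ℝ, Complex.exp (Complex.I * t * ϖ.toFun k) *
            ((F t * ip f (ϖ.evol t g) ^ n) * (conj (f k) * g k)) := integral_integral_swap hint
      _ = ∫ k : Mom d, 0 := by
          congr 1
          funext k
          have h := ih (hF.exp_mul (ϖ.mass_pos.le.trans (ϖ.mass_le k)))
          rw [← zero_mul (conj (f k) * g k), ← h, ← integral_mul_const]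
          congr 1
          funext t
          ring
      _ = 0 := integral_zero _ _

theorem IsNegFreq.integral_mul_exp_ip (ϖ : Dispersion d) (f g : Test d) (c : ℂ) {F : ℝ → ℂ}
    (hF : IsNegFreq F) : ∫ t : ℝ, F t * Complex.exp (c * ip f (ϖ.evol t g)) = 0 := by
  set M : ℝ := ∫ k, ‖conj (f k) * g k‖
  have hG := continuous_ip_evol ϖ f g
  have hsum := hasSum_integral_of_dominated_convergence (μ := volume)
    (F := fun (n : ℕ) t => F t * ((c * ip f (ϖ.evol t g)) ^ n / n.factorial))
    (f := fun t => F t * Complex.exp (c * ip f (ϖ.evol t g)))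
    (fun n t => ‖F t‖ * ((‖c‖ * M) ^ n / n.factorial))
    (fun n => hF.integrable.aestronglyMeasurable.mul
      (Continuous.aestronglyMeasurable (by fun_prop)))
    (fun n => ae_of_all _ fun t => by
      rw [norm_mul, norm_div, norm_pow, norm_mul, Complex.norm_natCast]
      gcongr
      exact norm_ip_evol_le ϖ f g t)
    (ae_of_all _ fun t => (Real.summable_pow_div_factorial _).mul_left _)
    (by simp only [tsum_mul_left]; exact hF.integrable.norm.mul_const _)
    (ae_of_all _ fun t => by
      have := NormedSpace.expSeries_div_hasSum_exp (𝔸 := ℂ) (c * ip f (ϖ.evol t g))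
      rw [← Complex.exp_eq_exp_ℂ] at this
      exact this.mul_left _)
  refine hsum.unique ?_
  have hterm : (fun n : ℕ => ∫ t : ℝ, F t * ((c * ip f (ϖ.evol t g)) ^ n / n.factorial)) = 0 := by
    funext n
    rw [Pi.zero_apply, ← mul_zero (c ^ n / (n.factorial : ℂ)), ← hF.integral_mul_ip_pow ϖ f g n,
      ← integral_const_mul]
    congr 1
    funext t
    rw [mul_pow]
    ring
  rw [hterm]
  exact hasSum_zero

/-! ### The ground state -/

/-- Continuity in time, and vanishing of the integral against `F`, pass from the Weyl operators to
the CCR algebra for a uniformly bounded family of functionals. Continuity is part of the claim since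
it supplies the measurability that makes the integral linear and continuous in `a`. -/
theorem integral_mul_eq_zero_of_W {F : ℝ → ℂ} (hF : Integrable F)
    {ℓ : ℝ → CCR d →ₗ[ℂ] ℂ} {C : ℝ} (hC : ∀ t a, ‖ℓ t a‖ ≤ C * ‖a‖)
    (hcont : ∀ f, Continuous fun t => ℓ t (W f)) (hzero : ∀ f, ∫ t : ℝ, F t * ℓ t (W f) = 0)
    (a : CCR d) : (Continuous fun t => ℓ t a) ∧ ∫ t : ℝ, F t * ℓ t a = 0 := by
  have hc : ∀ a, Continuous fun t => ℓ t a := by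
    refine ccr_induction hcont (fun a b ha hb => by simp only [map_add]; exact Continuous.add ha hb)
      (fun c a ha => by simp only [map_smul]; exact Continuous.const_smul ha c) ?_
    refine isClosed_of_closure_subset fun a ha => ?_
    refine continuous_of_uniform_approx_of_continuous fun u hu => ?_
    obtain ⟨ε, hε, hεu⟩ := Metric.mem_uniformity_dist.1 hu
    obtain ⟨b, hb, hab⟩ := Metric.mem_closure_iff.1 ha (ε / (|C| + 1)) (by positivity)
    refine ⟨fun t => ℓ t b, hb, fun t => hεu ?_⟩
    rw [dist_eq_norm, ← map_sub]
    rw [dist_eq_norm, lt_div_iff₀ (by positivity)] at hab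
    calc _ ≤ C * ‖a - b‖ := hC t _
      _ ≤ (|C| + 1) * ‖a - b‖ := by gcongr; linarith [le_abs_self C]
      _ < ε := by rwa [mul_comm]
  have hint : ∀ a, Integrable fun t => F t * ℓ t a := fun a =>
    hF.mul_bdd (hc a).aestronglyMeasurable (ae_of_all _ fun t => hC t a)
  refine ⟨hc a, ?_⟩
  refine ccr_induction (p := fun a => ∫ t : ℝ, F t * ℓ t a = 0) hzero (fun a b ha hb => ?_)
    (fun c a ha => ?_) ?_ a
  · simp only [map_add, mul_add]
    rw [integral_add (hint a) (hint b), ha, hb, add_zero]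
  · simp only [map_smul, smul_eq_mul, mul_left_comm _ c]
    rw [integral_const_mul, ha, mul_zero]
  · refine isClosed_eq (f := fun a => ∫ t : ℝ, F t * ℓ t a) ?_ continuous_const
    refine (AddMonoidHomClass.continuous_of_bound (AddMonoidHom.mk' (fun a => ∫ t : ℝ, F t * ℓ t a)
      fun a b => ?_) ((∫ t : ℝ, ‖F t‖) * C) fun a => ?_ :)
    · simp only [map_add, mul_add]
      exact integral_add (hint a) (hint b)
    · refine (norm_integral_le_integral_norm _).trans ?_
      rw [mul_assoc, ← integral_mul_const]
      refine integral_mono (hint a).norm (hF.norm.mul_const _) fun t => ?_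
      rw [norm_mul]
      exact mul_le_mul_of_nonneg_left (hC t a) (norm_nonneg _)

/-- The two-point function of the coherent state. The phase of the dynamics moves the centre `-v/ϖ`
in the way that makes it stationary, so that time enters only through `e^{-π²⟨f, e^{itϖ}g⟩}`. -/
theorem IsCoherentState.apply_W_mul_dynamics {ϖ : Dispersion d} {v : Distr d}
    {τ : ℝ → (CCR d ≃⋆ₐ[ℂ] CCR d)} {ω : CCR d →L[ℂ] ℂ} (hτ : IsDynamicalMap ϖ v τ)
    (hω : IsCoherentState (-(ϖ.divDistr v)) ω) (f g : Test d) (t : ℝ) :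
    ω (W f * τ t (W g)) = ω (W f) * ω (W g) *
      Complex.exp (-(Real.pi ^ 2 : ℂ) * ip f (ϖ.evol t g)) := by
  have hbr : ∀ h : Test d, bracket h (-(ϖ.divDistr v)) = -bracket h (ϖ.divDistr v) := fun _ => rfl
  have hgg : ip (ϖ.evol t g) (ϖ.evol t g) = ip g g := ϖ.ip_evol_evol t g g
  have him : ((ip f (ϖ.evol t g)).im : ℂ) * Complex.I =
      (ip f (ϖ.evol t g) - ip (ϖ.evol t g) f) / 2 := by
    rw [← conj_ip f (ϖ.evol t g), Complex.sub_conj]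
    push_cast
    ring
  rw [hτ.map_W, ϖ.vanHovePhase_eq, mul_smul_comm, W_mul_W, map_smul, map_smul, hω.apply_W,
    hω.apply_W, hω.apply_W, smul_eq_mul, smul_eq_mul, weylPhase, Dispersion.vanHovePhase]
  simp only [← Complex.exp_add, hbr, bracket_add_left, ip_add_left, ip_add_right, hgg,
    Complex.add_re, Complex.neg_re]
  congr 1
  push_cast
  linear_combination -(Real.pi : ℂ) ^ 2 * him

theorem isGroundState_of_isCoherentState {ϖ : Dispersion d} {v : Distr d}
    {τ : ℝ → (CCR d ≃⋆ₐ[ℂ] CCR d)} {ω : CCR d →L[ℂ] ℂ} (hτ : IsDynamicalMap ϖ v τ)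
    (hω : IsCoherentState (-(ϖ.divDistr v)) ω) : IsGroundState τ ω := by
  have hbound : ∀ t a b, ‖ω (a * τ t b)‖ ≤ ‖ω‖ * ‖a‖ * ‖b‖ := fun t a b => by
    have h1 : ‖τ t b‖ = ‖b‖ := (hτ.isometry t).norm_map_of_map_zero (map_zero _) b
    calc _ ≤ ‖ω‖ * ‖a * τ t b‖ := ω.le_opNorm _
      _ ≤ ‖ω‖ * (‖a‖ * ‖τ t b‖) := by gcongr; exact norm_mul_le _ _
      _ = _ := by rw [h1, mul_assoc]
  have key : ∀ {F : ℝ → ℂ}, IsNegFreq F → ∀ a b, (Continuous fun t => ω (a * τ t b)) ∧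
      ∫ t : ℝ, F t * ω (a * τ t b) = 0 := by
    intro F hF a b
    have hW : ∀ f, (Continuous fun t => ω (W f * τ t b)) ∧ ∫ t : ℝ, F t * ω (W f * τ t b) = 0 := by
      intro f
      refine integral_mul_eq_zero_of_W hF.integrable (C := ‖ω‖ * ‖W f‖)
        (ℓ := fun t => ω.toLinearMap ∘ₗ LinearMap.mulLeft ℂ (W f) ∘ₗ
          (τ t).toAlgEquiv.toLinearMap) (fun t b => hbound t _ _) (fun g => ?_) (fun g => ?_) b
      · change Continuous fun t => ω (W f * τ t (W g))
        simp only [hω.apply_W_mul_dynamics hτ]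
        have := continuous_ip_evol ϖ f g
        fun_prop
      · change ∫ t : ℝ, F t * ω (W f * τ t (W g)) = 0
        simp only [hω.apply_W_mul_dynamics hτ, mul_left_comm (F _)]
        rw [integral_const_mul, hF.integral_mul_exp_ip, mul_zero]
    exact integral_mul_eq_zero_of_W hF.integrable (C := ‖ω‖ * ‖b‖)
      (ℓ := fun t => ω.toLinearMap ∘ₗ LinearMap.mulRight ℂ (τ t b))
      (fun t a => (hbound t a b).trans_eq (mul_right_comm _ _ _))
      (fun f => (hW f).1) (fun f => (hW f).2) a
  refine ⟨hω.isState, fun φ a b => ?_, fun φ a b => (key (isNegFreq_invFourier φ) a b).2⟩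
  exact (isNegFreq_invFourier φ).integrable.mul_bdd
    (key (isNegFreq_invFourier φ) a b).1.aestronglyMeasurable
    (ae_of_all _ fun t => hbound t a b)

end VanHove

end

theorem mainTheorem4 (d : ℕ) (ϖ : VanHove.Dispersion d) (v : VanHove.Distr d) :
    (∃! τ : ℝ → (VanHove.CCR d ≃⋆ₐ[ℂ] VanHove.CCR d), VanHove.IsDynamicalMap ϖ v τ) ∧
    (∃! ω : VanHove.CCR d →L[ℂ] ℂ, VanHove.IsCoherentState (-(ϖ.divDistr v)) ω) ∧
    ∀ (τ : ℝ → (VanHove.CCR d ≃⋆ₐ[ℂ] VanHove.CCR d)) (ω : VanHove.CCR d →L[ℂ] ℂ),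
      VanHove.IsDynamicalMap ϖ v τ → VanHove.IsCoherentState (-(ϖ.divDistr v)) ω →
      VanHove.IsGroundState τ ω := by
  exact ⟨VanHove.existsUnique_dynamicalMap ϖ v, VanHove.existsUnique_coherentState _,
    fun _ _ hτ hω => VanHove.isGroundState_of_isCoherentState hτ hω⟩
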